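/- Consider a trial-offer market with $N\ge 1$ items and $K\ge 1$ classes of consumers that follows a mixed multinomial logit (MMNL) model. Its data are arrival rates $\lambda_k>0$, giving class weights $w_k=\lambda_k/\sum_{l}\lambda_l$; visibilities $v_1\ge v_2\ge\dots\ge v_N\ge 0$ of the positions, with $v_1>0$; appeals $a_{i,k}>0$; qualities $q_{i,k}\in[0,1]$, not all zero; and a constant $z\ge 0$. Consumers arrive one at a time. Each one is of class $k$ with probability $w_k$, independently of the past. If she is of class $k$, the items are placed according to a permutation $\sigma$ (item $i$ in position $\sigma(i)$) and the popularity vector $s\in\mathbb N^N$ is displayed, then she tries item $i$ with probability $$p_{i,k}(\sigma,s)=\frac{v_{\sigma(i)}(a_{i,k}+s_i)}{\sum_{j=1}^N v_{\sigma(j)}(a_{j,k}+s_j)+z}$$ (at most one item is tried), and she buys the tried item with probability $q_{i,k}$. Let $d^t\in\mathbb N^N$ be the vector of the numbers of purchases of each item before time $t$, with $d^0=0$. With the global popularity signal the displayed vector at time $t$ is $s=d^t$; without the signal it is always $s=0$. The weighted average quality of item $i$ is $\bar q_i=\sum_{k}w_kq_{i,k}$. Let $\sigma$ be an average quality ranking,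 that is, a fixed permutation that orders the items by decreasing $\bar q_i$ (ties broken arbitrarily). Let $P^t_{AQGSI}$ and $P^t_{AQNSI}$ be the probabilities that the consumer arriving at time $t$ makes a purchase under the ranking $\sigma$, with the global popularity signal and without it, respectively. Then the limits $P_{AQGSI}=\lim_{t\to\infty}P^t_{AQGSI}$ and $P_{AQNSI}=\lim_{t\to\infty}P^t_{AQNSI}$ exist, $$P_{AQGSI}=\max_{1\le i\le N}\bar q_i>0,\qquad P_{AQNSI}=\sum_{k=1}^K w_k\sum_{i=1}^N q_{i,k}\frac{v_{\sigma(i)}a_{i,k}}{\sum_{j=1}^N v_{\sigma(j)}a_{j,k}+z},$$ with the signal also the conditional purchase probability $\sum_k w_k\sum_i p_{i,k}(\sigma,d^t)\,q_{i,k}$ given $d^t$ converges to $P_{AQGSI}$ almost surely, and $$0\le \frac{P_{AQNSI}}{P_{AQGSI}}\le K .$$ That is, under the average quality ranking the market can do at most $K$ times better without the popularity signal than with it. -/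

import Mathlib

open MeasureTheory ProbabilityTheory Filter Topology

/-- The data of a trial-offer market with `N` items and `K` classes of consumers whose
preferences follow a mixed multinomial logit (MMNL) model. -/
structure MMNLMarket (N K : ℕ) where
  /-- arrival rate of the consumers of class `k` -/
  rate : Fin K → ℝ
  rate_pos : ∀ k, 0 < rate k
  /-- there is at least one class of consumers -/
  K_pos : 0 < K
  /-- visibility of position `j`; the positions are sorted by decreasing visibility -/
  v : Fin N → ℝ
  v_nonneg : ∀ j, 0 ≤ v j
  v_antitone : Antitone v
  /-- intrinsic appeal of item `i` for class `k` -/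
  a : Fin N → Fin K → ℝ
  a_pos : ∀ i k, 0 < a i k
  /-- quality: probability that a consumer of class `k` who has tried item `i` buys it -/
  q : Fin N → Fin K → ℝ
  q_nonneg : ∀ i k, 0 ≤ q i k
  q_le_one : ∀ i k, q i k ≤ 1
  /-- constant weight of trying nothing -/
  z : ℝ
  z_nonneg : 0 ≤ z

namespace MMNLMarket

noncomputable section

variable {N K : ℕ} (M : MMNLMarket N K)

/-- The weight `w k` of class `k`: the probability that the next consumer is of class `k`. -/
def w (k : Fin K) : ℝ := M.rate k / ∑ l, M.rate l

/-- The weighted average quality of item `i`. -/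
def avgQuality (i : Fin N) : ℝ := ∑ k, M.w k * M.q i k

/-- `σ` (item `i` is placed in position `σ i`) orders the items by decreasing weighted average
quality; items of equal average quality may be placed in any order. -/
def IsAverageQualityRanking (σ : Equiv.Perm (Fin N)) : Prop :=
  ∀ i j, M.avgQuality j < M.avgQuality i → σ i < σ j

/-- The probability that a consumer of class `k`, facing the ranking `σ` and the displayed
popularity vector `s`, tries item `i`. -/
def tryProb (σ : Equiv.Perm (Fin N)) (s : Fin N → ℕ) (i : Fin N) (k : Fin K) : ℝ :=
  M.v (σ i) * (M.a i k + s i) / (∑ j, M.v (σ j) * (M.a j k + s j) + M.z)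

/-- The probability that the next consumer, facing the ranking `σ` and the displayed popularity
vector `s`, makes a purchase. -/
def purchaseProb (σ : Equiv.Perm (Fin N)) (s : Fin N → ℕ) : ℝ :=
  ∑ k, M.w k * ∑ i, M.tryProb σ s i k * M.q i k

theorem w_nonneg (k : Fin K) : 0 ≤ M.w k :=
  div_nonneg (M.rate_pos k).le (Finset.sum_nonneg fun l _ => (M.rate_pos l).le)

theorem sum_w : ∑ k, M.w k = 1 := by
  have : Nonempty (Fin K) := ⟨⟨0, M.K_pos⟩⟩
  have h : 0 < ∑ l, M.rate l :=
    Finset.sum_pos (fun l _ => M.rate_pos l) Finset.univ_nonempty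
  simp only [w, ← Finset.sum_div]
  exact div_self h.ne'

theorem tryNum_nonneg (σ : Equiv.Perm (Fin N)) (s : Fin N → ℕ) (i : Fin N) (k : Fin K) :
    0 ≤ M.v (σ i) * (M.a i k + s i) :=
  mul_nonneg (M.v_nonneg _) (add_nonneg (M.a_pos i k).le (Nat.cast_nonneg _))

theorem tryProb_nonneg (σ : Equiv.Perm (Fin N)) (s : Fin N → ℕ) (i : Fin N) (k : Fin K) :
    0 ≤ M.tryProb σ s i k :=
  div_nonneg (M.tryNum_nonneg σ s i k)
    (add_nonneg (Finset.sum_nonneg fun j _ => M.tryNum_nonneg σ s j k) M.z_nonneg)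

theorem sum_tryProb_le_one (σ : Equiv.Perm (Fin N)) (s : Fin N → ℕ) (k : Fin K) :
    ∑ i, M.tryProb σ s i k ≤ 1 := by
  simp only [tryProb, ← Finset.sum_div]
  exact div_le_one_of_le₀ (le_add_of_nonneg_right M.z_nonneg)
    (add_nonneg (Finset.sum_nonneg fun j _ => M.tryNum_nonneg σ s j k) M.z_nonneg)

/-- The law of the class of an arriving consumer. -/
def classLaw : PMF (Fin K) :=
  PMF.ofFintype (fun k => ENNReal.ofReal (M.w k)) (by
    rw [← ENNReal.ofReal_sum_of_nonneg fun k _ => M.w_nonneg k, M.sum_w, ENNReal.ofReal_one])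

/-- The law of the item tried by a consumer of class `k` facing the ranking `σ` and the displayed
popularity vector `s`; `none` means that she tries nothing. -/
def trialLaw (σ : Equiv.Perm (Fin N)) (s : Fin N → ℕ) (k : Fin K) : PMF (Option (Fin N)) :=
  PMF.ofFintype
    (fun o => o.elim (ENNReal.ofReal (1 - ∑ i, M.tryProb σ s i k))
      (fun i => ENNReal.ofReal (M.tryProb σ s i k))) (by
    rw [Fintype.sum_option]
    simp only [Option.elim]
    rw [← ENNReal.ofReal_sum_of_nonneg fun i _ => M.tryProb_nonneg σ s i k,
      ← ENNReal.ofReal_add (sub_nonneg.2 (M.sum_tryProb_le_one σ s k))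
        (Finset.sum_nonneg fun i _ => M.tryProb_nonneg σ s i k),
      sub_add_cancel, ENNReal.ofReal_one])

/-- The law of the decision (`true`: buy) of a consumer of class `k` who has tried item `i`. -/
def buyLaw (i : Fin N) (k : Fin K) : PMF Bool :=
  PMF.ofFintype
    (fun b => cond b (ENNReal.ofReal (M.q i k)) (ENNReal.ofReal (1 - M.q i k))) (by
    rw [Fintype.sum_bool]
    simp only [cond_true, cond_false]
    rw [← ENNReal.ofReal_add (M.q_nonneg i k) (sub_nonneg.2 (M.q_le_one i k)),
      add_sub_cancel, ENNReal.ofReal_one])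

/-- The law of the next sales vector, when `d` is the current sales vector, `σ` the ranking and
`s` the displayed popularity vector: a consumer arrives, tries at most one item, and the sales
of that item increase by one if she buys it. -/
def stepLaw (σ : Equiv.Perm (Fin N)) (s d : Fin N → ℕ) : PMF (Fin N → ℕ) :=
  M.classLaw.bind fun k =>
    (M.trialLaw σ s k).bind fun o =>
      match o with
      | none => PMF.pure d
      | some i => (M.buyLaw i k).map fun b => cond b (d + Pi.single i 1) d

/-- The transition kernel from the history `d⁰, …, dᵗ` of the sales vectors to `dᵗ⁺¹`. The ranking
`σ` is static, and `signal d` is what is displayed to the consumers when the sales vector is `d`. -/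
def transition (σ : Equiv.Perm (Fin N)) (signal : (Fin N → ℕ) → (Fin N → ℕ)) (t : ℕ) :
    Kernel ((i : Finset.Iic t) → (fun _ : ℕ => Fin N → ℕ) i) (Fin N → ℕ) :=
  Kernel.ofFunOfCountable fun h =>
    (M.stepLaw σ (signal (h ⟨t, Finset.mem_Iic.2 le_rfl⟩))
      (h ⟨t, Finset.mem_Iic.2 le_rfl⟩)).toMeasure

instance (σ : Equiv.Perm (Fin N)) (signal : (Fin N → ℕ) → (Fin N → ℕ)) (t : ℕ) :
    IsMarkovKernel (M.transition σ signal t) :=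
  ⟨fun _ => PMF.toMeasure.isProbabilityMeasure _⟩

/-- The law of the whole run `d⁰, d¹, d², …` of the market, started without any past purchase. -/
def runLaw (σ : Equiv.Perm (Fin N)) (signal : (Fin N → ℕ) → (Fin N → ℕ)) :
    Measure (ℕ → Fin N → ℕ) :=
  Kernel.traj (X := fun _ => Fin N → ℕ) (M.transition σ signal) 0 (fun _ => 0)

/-- The global popularity signal: the vector of past purchases is displayed. -/
def globalSignal (d : Fin N → ℕ) : Fin N → ℕ := d

/-- No popularity signal: the zero vector takes the place of the vector of past purchases. -/
def noSignal (_ : Fin N → ℕ) : Fin N → ℕ := 0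

/-- The probability that the consumer who arrives at time `t` makes a purchase. -/
def purchaseProbAt (σ : Equiv.Perm (Fin N)) (signal : (Fin N → ℕ) → (Fin N → ℕ)) (t : ℕ) : ℝ :=
  (M.runLaw σ signal).real {d | d (t + 1) ≠ d t}

end

end MMNLMarket

/-!
With the popularity signal the sales form a generalized Pólya urn in which the relative growth rate
of item `i` is nearly proportional to `v (σ i) * avgQuality i`. Let `m` be a best item that has the
best position. At time `t` it is purchased with conditional probability at least `c / (t + 1)`, so
its sales tend to infinity by the conditional Borel–Cantelli lemma. If `j` has a smaller average
quality, choose `η < 1` above the ratio of the growth rates of `j` and `m`: once the sales of `m`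
are large, `(d j + α) * d m ^ (-η)` is a nonnegative supermartingale, hence converges, and
`d j / d m → 0`. The appeals are negligible against the sales, so that all classes end up trying the
items with the same probabilities, which concentrate on the items of maximal average quality; this
gives the limit with the signal.

Without the signal the purchase probability does not depend on `t`. Since
`w k * q i k ≤ avgQuality i`, each class contributes at most the maximal average quality to it,
whence the factor `K`.
-/

section Martingale

variable {Ω : Type*} {m₀ : MeasurableSpace Ω} {μ : Measure Ω} [IsFiniteMeasure μ]
  {ℱ : Filtration ℕ m₀} {f : ℕ → Ω → ℝ}

theorem ae_exists_tendsto_of_supermartingale_of_nonneg (hf : Supermartingale f ℱ μ)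
    (hnonneg : ∀ n ω, 0 ≤ f n ω) : ∀ᵐ ω ∂μ, ∃ c, Tendsto (fun n => f n ω) atTop (𝓝 c) := by
  have hbdd (n : ℕ) : eLpNorm ((-f) n) 1 μ ≤ (∫ ω, f 0 ω ∂μ).toNNReal := by
    rw [Pi.neg_apply, eLpNorm_neg, eLpNorm_one_eq_lintegral_enorm,
      ← ofReal_integral_norm_eq_lintegral_enorm (hf.integrable n)]
    simp only [Real.norm_of_nonneg (hnonneg n _)]
    refine ENNReal.ofReal_le_ofReal ?_
    simpa using hf.setIntegral_le (Nat.zero_le n) MeasurableSet.univ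
  filter_upwards [hf.neg.exists_ae_tendsto_of_bdd hbdd] with ω ⟨c, hc⟩
  exact ⟨-c, by simpa using hc.neg⟩

theorem ae_restrict_exists_tendsto_of_condExp_sub_nonpos (hadp : StronglyAdapted ℱ f)
    (hint : ∀ n, Integrable (f n) μ) (hnonneg : ∀ n ω, 0 ≤ f n ω) {T : ℕ} {s : Set Ω}
    (hs : MeasurableSet[ℱ T] s)
    (hdec : ∀ n, T ≤ n → μ[f (n + 1) - f n | ℱ n] ≤ᵐ[μ.restrict s] 0) :
    ∀ᵐ ω ∂μ.restrict s, ∃ c, Tendsto (fun n => f n ω) atTop (𝓝 c) := by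
  let 𝒢 : Filtration ℕ m₀ :=
    { seq := fun n => ℱ (n + T)
      mono' := fun _ _ h => ℱ.mono (Nat.add_le_add_right h T)
      le' := fun n => ℱ.le (n + T) }
  have hsuper : Supermartingale (fun n => f (n + T)) 𝒢 (μ.restrict s) := by
    refine supermartingale_of_condExp_sub_nonneg_nat (fun n => hadp (n + T))
      (fun n => (hint (n + T)).restrict) fun n => ?_
    have hsn : MeasurableSet[ℱ (n + T)] s := ℱ.mono (Nat.le_add_left T n) s hs
    have hrestrict := condExp_restrict_ae_eq_restrict (ℱ.le (n + T)) hsn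
      ((hint (n + T)).sub (hint (n + T + 1)))
    have hneg := ae_restrict_of_ae (s := s)
      (condExp_neg (μ := μ) (f (n + T + 1) - f (n + T)) (ℱ (n + T)))
    rw [neg_sub] at hneg
    filter_upwards [hrestrict, hneg, hdec (n + T) (Nat.le_add_left T n)] with ω h₁ h₂ h₃
    rw [add_right_comm n 1 T]
    exact (neg_nonneg.2 h₃).trans (h₂.symm.trans h₁.symm).le
  filter_upwards [ae_exists_tendsto_of_supermartingale_of_nonneg hsuper
    fun n => hnonneg (n + T)] with ω ⟨c, hc⟩
  exact ⟨c, (tendsto_add_atTop_iff_nat T).1 hc⟩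

theorem ae_tendsto_atTop_of_div_le_condExp_sub (hadp : StronglyAdapted ℱ f)
    (hint : ∀ n, Integrable (f n) μ) (hmono : ∀ᵐ ω ∂μ, ∀ n, f n ω ≤ f (n + 1) ω) {R : NNReal}
    (hbdd : ∀ᵐ ω ∂μ, ∀ n, |f (n + 1) ω - f n ω| ≤ R) {c : ℝ} (hc : 0 < c)
    (hcond : ∀ n : ℕ, ∀ᵐ ω ∂μ, c / (n + 1) ≤ μ[f (n + 1) - f n | ℱ n] ω) :
    ∀ᵐ ω ∂μ, Tendsto (fun n => f n ω) atTop atTop := by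
  filter_upwards [tendsto_sum_indicator_atTop_iff hmono hadp hint hbdd, ae_all_iff.2 hcond]
    with ω hiff hω
  have hharmonic : Tendsto (fun n => ∑ t ∈ Finset.range n, c / ((t : ℝ) + 1)) atTop atTop := by
    simpa only [Finset.mul_sum, mul_one_div] using
      Real.tendsto_sum_range_one_div_nat_succ_atTop.const_mul_atTop hc
  refine hiff.2 (tendsto_atTop_mono (fun n => ?_) hharmonic)
  rw [predictablePart, Finset.sum_apply]
  exact Finset.sum_le_sum fun t _ => hω t

end Martingale

theorem condExp_traj_succ {X : ℕ → Type*} [∀ n, MeasurableSpace (X n)]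
    {κ : (n : ℕ) → Kernel ((i : Finset.Iic n) → X i) (X (n + 1))} [∀ n, IsMarkovKernel (κ n)]
    {E : Type*} [NormedAddCommGroup E] [NormedSpace ℝ E] [CompleteSpace E]
    {a b : ℕ} (hab : a ≤ b) {x₀ : (i : Finset.Iic a) → X i}
    {f : ((i : Finset.Iic b) → X i) → X (b + 1) → E} (hf : StronglyMeasurable f.uncurry)
    (hint : Integrable (fun x => f (Preorder.frestrictLe b x) (x (b + 1)))
      (Kernel.traj κ a x₀)) :
    (Kernel.traj κ a x₀)[fun x => f (Preorder.frestrictLe b x) (x (b + 1)) | Filtration.piLE b]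
      =ᵐ[Kernel.traj κ a x₀]
        fun x => ∫ y, f (Preorder.frestrictLe b x) y ∂κ b (Preorder.frestrictLe b x) := by
  filter_upwards [Kernel.condExp_traj hab hint] with x hx
  have hmeas : StronglyMeasurable fun y : (n : ℕ) → X n =>
      f (Preorder.frestrictLe b y) (y (b + 1)) :=
    hf.comp_measurable (g := fun y : (n : ℕ) → X n => (Preorder.frestrictLe b y, y (b + 1)))
      (by fun_prop)
  have hsection : StronglyMeasurable (f (Preorder.frestrictLe b x)) :=
    hf.comp_measurable measurable_prodMk_left
  have hupdate (y : (n : ℕ) → X n) :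
      Preorder.frestrictLe b (Function.updateFinset y (Finset.Iic b) (Preorder.frestrictLe b x)) =
        Preorder.frestrictLe b x := by
    ext i
    simp [Function.updateFinset]
  rw [hx, Kernel.integral_traj _ hmeas.aestronglyMeasurable, ← Kernel.map_traj_succ_self (κ := κ),
    Kernel.map_apply _ (measurable_pi_apply _),
    integral_map (measurable_pi_apply _).aemeasurable hsection.aestronglyMeasurable]
  congr with y
  rw [hupdate]
  simp [Function.updateFinset]

theorem toMeasure_bind_eq_sum {α β : Type*} [Fintype α] [MeasurableSpace β] (p : PMF α)
    (f : α → PMF β) : (p.bind f).toMeasure = ∑ a, p a • (f a).toMeasure := by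
  ext s hs
  simp [PMF.toMeasure_bind_apply _ _ _ hs, tsum_fintype]

theorem rpow_neg_add_one_le {η x : ℝ} (hη₀ : 0 ≤ η) (hη₁ : η ≤ 1) (hx : 0 < x) :
    (x + 1) ^ (-η) ≤ x ^ (-η) * (1 - η / (x + 1)) := by
  have hx1 : 0 < x + 1 := by linarith
  have hbernoulli : (x / (x + 1)) ^ η ≤ 1 - η / (x + 1) := by
    have h := rpow_one_add_le_one_add_mul_self (s := -(1 / (x + 1))) (p := η)
      (neg_le_neg ((div_le_one hx1).2 (by linarith))) hη₀ hη₁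
    rwa [show 1 + -(1 / (x + 1)) = x / (x + 1) by field_simp; ring,
      show 1 + η * -(1 / (x + 1)) = 1 - η / (x + 1) by ring] at h
  calc (x + 1) ^ (-η) = x ^ (-η) * (x / (x + 1)) ^ η := by
        rw [Real.div_rpow hx.le hx1.le, Real.rpow_neg hx.le, Real.rpow_neg hx1.le]
        field_simp
    _ ≤ x ^ (-η) * (1 - η / (x + 1)) := by gcongr

section FinitePMF

variable {α β : Type*} [MeasurableSpace β] {p : PMF α} {f : α → PMF β} {g : β → ℝ}

theorem integrable_toMeasure_bind [Finite α] (hg : ∀ a, Integrable g (f a).toMeasure) :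
    Integrable g (p.bind f).toMeasure := by
  have := Fintype.ofFinite α
  rw [toMeasure_bind_eq_sum]
  exact integrable_finsetSum_measure.2 fun a _ => (hg a).smul_measure (p.apply_ne_top a)

theorem integral_toMeasure_bind [Fintype α] (hg : ∀ a, Integrable g (f a).toMeasure) :
    ∫ x, g x ∂(p.bind f).toMeasure = ∑ a, (p a).toReal * ∫ x, g x ∂(f a).toMeasure := by
  rw [toMeasure_bind_eq_sum,
    integral_finsetSum_measure fun a _ => (hg a).smul_measure (p.apply_ne_top a)]
  simp only [integral_smul_measure, smul_eq_mul]

end FinitePMF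

namespace MMNLMarket

noncomputable section

variable {N K : ℕ} (M : MMNLMarket N K) (σ : Equiv.Perm (Fin N))
  (signal : (Fin N → ℕ) → (Fin N → ℕ)) {s : Fin N → ℕ}

/-- The probability that the next consumer, facing the ranking `σ` and the displayed popularity
vector `s`, purchases item `i`. -/
def buyProb (σ : Equiv.Perm (Fin N)) (s : Fin N → ℕ) (i : Fin N) : ℝ :=
  ∑ k, M.w k * (M.tryProb σ s i k * M.q i k)

theorem buyProb_nonneg (s : Fin N → ℕ) (i : Fin N) : 0 ≤ M.buyProb σ s i :=
  Finset.sum_nonneg fun k _ =>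
    mul_nonneg (M.w_nonneg k) (mul_nonneg (M.tryProb_nonneg σ s i k) (M.q_nonneg i k))

theorem purchaseProb_eq_sum_buyProb (s : Fin N → ℕ) :
    M.purchaseProb σ s = ∑ i, M.buyProb σ s i := by
  simp only [purchaseProb, buyProb, Finset.mul_sum]
  exact Finset.sum_comm

theorem purchaseProb_nonneg (s : Fin N → ℕ) : 0 ≤ M.purchaseProb σ s := by
  rw [purchaseProb_eq_sum_buyProb]
  exact Finset.sum_nonneg fun i _ => M.buyProb_nonneg σ s i

theorem purchaseProb_le_one (s : Fin N → ℕ) : M.purchaseProb σ s ≤ 1 := by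
  rw [← M.sum_w]
  refine Finset.sum_le_sum fun k _ => mul_le_of_le_one_right (M.w_nonneg k) ?_
  refine le_trans (Finset.sum_le_sum fun i _ => ?_) (M.sum_tryProb_le_one σ s k)
  exact mul_le_of_le_one_right (M.tryProb_nonneg σ s i k) (M.q_le_one i k)

/-- The law of the next sales vector when `d` is the current one and the arriving consumer, of
class `k`, has tried the item `o`, or nothing if `o = none`: the last stage of `stepLaw`. -/
def trialStepLaw (k : Fin K) (d : Fin N → ℕ) (o : Option (Fin N)) : PMF (Fin N → ℕ) :=
  match o with
  | none => PMF.pure d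
  | some i => (M.buyLaw i k).map fun b => cond b (d + Pi.single i 1) d

theorem integrable_trialStepLaw (k : Fin K) (d : Fin N → ℕ) (o : Option (Fin N))
    (g : (Fin N → ℕ) → ℝ) : Integrable g (M.trialStepLaw k d o).toMeasure := by
  cases o with
  | none =>
    rw [trialStepLaw, PMF.toMeasure_pure]
    exact integrable_dirac enorm_lt_top
  | some i =>
    rw [trialStepLaw, ← PMF.toMeasure_map _ _ .of_discrete, integrable_map_measure
      Measurable.of_discrete.aestronglyMeasurable Measurable.of_discrete.aemeasurable]
    exact .of_finite

theorem integral_trialStepLaw_none (k : Fin K) (d : Fin N → ℕ) (g : (Fin N → ℕ) → ℝ) :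
    ∫ x, g x ∂(M.trialStepLaw k d none).toMeasure = g d := by
  rw [trialStepLaw, PMF.toMeasure_pure, integral_dirac]

theorem integral_trialStepLaw_some (k : Fin K) (d : Fin N → ℕ) (i : Fin N)
    (g : (Fin N → ℕ) → ℝ) :
    ∫ x, g x ∂(M.trialStepLaw k d (some i)).toMeasure =
      g d + M.q i k * (g (d + Pi.single i 1) - g d) := by
  rw [trialStepLaw, ← PMF.toMeasure_map _ _ .of_discrete, integral_map
    Measurable.of_discrete.aemeasurable Measurable.of_discrete.aestronglyMeasurable,
    PMF.integral_eq_sum, Fintype.sum_bool]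
  simp only [buyLaw, PMF.ofFintype_apply, cond_true, cond_false, smul_eq_mul,
    ENNReal.toReal_ofReal (M.q_nonneg i k), ENNReal.toReal_ofReal (sub_nonneg.2 (M.q_le_one i k))]
  ring

theorem integral_trialLaw_bind_trialStepLaw (s : Fin N → ℕ) (k : Fin K) (d : Fin N → ℕ)
    (g : (Fin N → ℕ) → ℝ) :
    ∫ x, g x ∂((M.trialLaw σ s k).bind (M.trialStepLaw k d)).toMeasure =
      g d + ∑ i, M.tryProb σ s i k * M.q i k * (g (d + Pi.single i 1) - g d) := by
  rw [integral_toMeasure_bind fun o => M.integrable_trialStepLaw k d o g, Fintype.sum_option]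
  simp only [integral_trialStepLaw_none, integral_trialStepLaw_some, trialLaw,
    PMF.ofFintype_apply, Option.elim,
    ENNReal.toReal_ofReal (sub_nonneg.2 (M.sum_tryProb_le_one σ s k)),
    ENNReal.toReal_ofReal (M.tryProb_nonneg σ s _ k), mul_add, Finset.sum_add_distrib,
    ← Finset.sum_mul, ← mul_assoc]
  ring

theorem integral_stepLaw (s d : Fin N → ℕ) (g : (Fin N → ℕ) → ℝ) :
    ∫ x, g x ∂(M.stepLaw σ s d).toMeasure =
      g d + ∑ i, M.buyProb σ s i * (g (d + Pi.single i 1) - g d) := by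
  have hstep : M.stepLaw σ s d =
      M.classLaw.bind fun k => (M.trialLaw σ s k).bind (M.trialStepLaw k d) := rfl
  rw [hstep, integral_toMeasure_bind fun k =>
    integrable_toMeasure_bind fun o => M.integrable_trialStepLaw k d o g]
  simp only [integral_trialLaw_bind_trialStepLaw, classLaw, PMF.ofFintype_apply,
    ENNReal.toReal_ofReal (M.w_nonneg _), mul_add, Finset.sum_add_distrib]
  rw [← Finset.sum_mul, M.sum_w, one_mul]
  simp only [buyProb, Finset.mul_sum, Finset.sum_mul]
  rw [Finset.sum_comm]
  simp only [mul_assoc]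

instance : IsProbabilityMeasure (M.runLaw σ signal) :=
  inferInstanceAs (IsProbabilityMeasure (Kernel.traj (X := fun _ => Fin N → ℕ) _ 0 _))

/-- The filtration of the histories `d⁰, …, dᵗ` of the sales vectors. -/
abbrev history (N : ℕ) :
    Filtration ℕ (MeasurableSpace.pi : MeasurableSpace (ℕ → Fin N → ℕ)) :=
  Filtration.piLE (X := fun _ : ℕ => Fin N → ℕ)

theorem stronglyMeasurable_history (g : (Fin N → ℕ) → ℝ) (t : ℕ) :
    StronglyMeasurable[history N t] fun d : ℕ → Fin N → ℕ => g (d t) := by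
  rw [history, Filtration.piLE_eq_comap_frestrictLe]
  exact (((Measurable.of_discrete (f := g)).comp
    (measurable_pi_apply (X := fun _ : Finset.Iic t => Fin N → ℕ) ⟨t, by simp⟩)).comp
      (comap_measurable _)).stronglyMeasurable

theorem condExp_runLaw {t : ℕ} {G : (Fin N → ℕ) → (Fin N → ℕ) → ℝ}
    (hG : Integrable (fun d => G (d t) (d (t + 1))) (M.runLaw σ signal)) :
    (M.runLaw σ signal)[fun d => G (d t) (d (t + 1)) | history N t] =ᵐ[M.runLaw σ signal]
      fun d => G (d t) (d t) + ∑ i, M.buyProb σ (signal (d t)) i *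
        (G (d t) (d t + Pi.single i 1) - G (d t) (d t)) := by
  let onHistory (h : (i : Finset.Iic t) → (fun _ : ℕ => Fin N → ℕ) i) (y : Fin N → ℕ) : ℝ :=
    G (h ⟨t, Finset.mem_Iic.2 le_rfl⟩) y
  have hmeas : StronglyMeasurable onHistory.uncurry := Measurable.of_discrete.stronglyMeasurable
  have hcond := condExp_traj_succ (X := fun _ => Fin N → ℕ) (κ := M.transition σ signal)
    (Nat.zero_le t) (x₀ := fun _ => 0) hmeas hG
  filter_upwards [hcond] with d hd
  exact hd.trans (M.integral_stepLaw σ (signal (d t)) (d t) (G (d t)))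

theorem ae_runLaw_zero : ∀ᵐ d ∂M.runLaw σ signal, d 0 = 0 := by
  have hmeas : MeasurableSet {d : ℕ → Fin N → ℕ | d 0 = 0} :=
    measurable_pi_apply 0 (.singleton _)
  rw [runLaw, ← Kernel.traj_map_updateFinset,
    ae_map_iff measurable_updateFinset_left.aemeasurable hmeas]
  simp [Function.updateFinset]

theorem ae_runLaw_step : ∀ᵐ d ∂M.runLaw σ signal, ∀ t,
    d (t + 1) = d t ∨ ∃ i, d (t + 1) = d t + Pi.single i 1 := by
  classical
  refine ae_all_iff.2 fun t => ?_
  let G (x y : Fin N → ℕ) : ℝ := if y = x ∨ ∃ i, y = x + Pi.single i 1 then 0 else 1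
  have hG (x y : Fin N → ℕ) : 0 ≤ G x y ∧ G x y ≤ 1 := by
    dsimp only [G]
    split_ifs <;> norm_num
  have hint : Integrable (fun d => G (d t) (d (t + 1))) (M.runLaw σ signal) := by
    have hmeas : Measurable fun d : ℕ → Fin N → ℕ => G (d t) (d (t + 1)) :=
      Measurable.comp (g := Function.uncurry G)
        (f := fun d : ℕ → Fin N → ℕ => (d t, d (t + 1))) .of_discrete (by fun_prop)
    refine .of_bound hmeas.aestronglyMeasurable 1 (.of_forall fun d => ?_)
    rw [Real.norm_of_nonneg (hG _ _).1]
    exact (hG _ _).2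
  have hzero : ∫ d, G (d t) (d (t + 1)) ∂M.runLaw σ signal = 0 := by
    rw [← integral_condExp ((history N).le t), integral_congr_ae (M.condExp_runLaw σ signal hint)]
    have hstay (x : Fin N → ℕ) : G x x = 0 := if_pos (Or.inl rfl)
    have hbuy (x : Fin N → ℕ) (i : Fin N) : G x (x + Pi.single i 1) = 0 :=
      if_pos (Or.inr ⟨i, rfl⟩)
    simp [hstay, hbuy]
  filter_upwards [(integral_eq_zero_iff_of_nonneg (fun d => (hG _ _).1) hint).1 hzero] with d hd
  by_contra hstep
  exact one_ne_zero ((if_neg hstep).symm.trans hd)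

theorem ae_runLaw_monotone : ∀ᵐ d ∂M.runLaw σ signal, Monotone d := by
  filter_upwards [M.ae_runLaw_step σ signal] with d hd
  refine monotone_nat_of_le_succ fun t => ?_
  rcases hd t with h | ⟨i, h⟩ <;> rw [h]
  exact le_self_add

theorem ae_runLaw_le : ∀ᵐ d ∂M.runLaw σ signal, ∀ t, ∑ i, d t i ≤ t := by
  filter_upwards [M.ae_runLaw_step σ signal, M.ae_runLaw_zero σ signal] with d hd h0 t
  induction t with
  | zero => simp [h0]
  | succ t ih =>
    rcases hd t with h | ⟨i, h⟩
    · rw [h]; lia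
    · simpa [h, Finset.sum_add_distrib] using ih

theorem integrable_runLaw (g : (Fin N → ℕ) → ℝ) (t : ℕ) :
    Integrable (fun d => g (d t)) (M.runLaw σ signal) := by
  obtain ⟨C, hC⟩ := ((Set.finite_Iic (fun _ => t : Fin N → ℕ)).image fun s => ‖g s‖).bddAbove
  refine .of_bound
    ((stronglyMeasurable_history g t).mono ((history N).le t)).aestronglyMeasurable C ?_
  filter_upwards [M.ae_runLaw_le σ signal] with d hd
  exact hC ⟨d t, fun i => (Finset.single_le_sum_of_canonicallyOrdered
    (Finset.mem_univ i)).trans (hd t), rfl⟩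

/-- The expected increment of the function `g` of the sales vector at the next consumer. -/
def drift (g : (Fin N → ℕ) → ℝ) (d : Fin N → ℕ) : ℝ :=
  ∑ i, M.buyProb σ (signal d) i * (g (d + Pi.single i 1) - g d)

theorem condExp_runLaw_sub (g : (Fin N → ℕ) → ℝ) (t : ℕ) :
    (M.runLaw σ signal)[(fun d => g (d (t + 1))) - (fun d => g (d t)) | history N t]
      =ᵐ[M.runLaw σ signal] fun d => M.drift σ signal g (d t) := by
  have hint := (M.integrable_runLaw σ signal g (t + 1)).sub (M.integrable_runLaw σ signal g t)
  filter_upwards [M.condExp_runLaw σ signal (G := fun x y => g y - g x) hint] with d hd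
  refine hd.trans ?_
  simp [drift]

theorem purchaseProbAt_eq_integral (t : ℕ) :
    M.purchaseProbAt σ signal t =
      ∫ d, M.purchaseProb σ (signal (d t)) ∂M.runLaw σ signal := by
  classical
  let G (x y : Fin N → ℕ) : ℝ := if y = x then 0 else 1
  have hmeas : MeasurableSet {d : ℕ → Fin N → ℕ | d (t + 1) ≠ d t} :=
    (measurableSet_eq_fun (by fun_prop) (by fun_prop)).compl
  have hG : {d : ℕ → Fin N → ℕ | d (t + 1) ≠ d t}.indicator 1 =
      fun d => G (d t) (d (t + 1)) := by
    ext d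
    simp [G, Set.indicator_apply]
  have hint : Integrable (fun d => G (d t) (d (t + 1))) (M.runLaw σ signal) :=
    hG ▸ (integrable_const 1).indicator hmeas
  rw [purchaseProbAt, ← integral_indicator_one hmeas, hG, ← integral_condExp ((history N).le t),
    integral_congr_ae (M.condExp_runLaw σ signal hint)]
  simp [G, purchaseProb_eq_sum_buyProb]

theorem purchaseProbAt_noSignal (t : ℕ) :
    M.purchaseProbAt σ noSignal t = M.purchaseProb σ 0 := by
  rw [purchaseProbAt_eq_integral]
  simp [noSignal]

theorem tendsto_purchaseProbAt {C : ℝ}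
    (h : ∀ᵐ d ∂M.runLaw σ signal,
      Tendsto (fun t => M.purchaseProb σ (signal (d t))) atTop (𝓝 C)) :
    Tendsto (M.purchaseProbAt σ signal) atTop (𝓝 C) := by
  have hlim := tendsto_integral_of_dominated_convergence (fun _ => (1 : ℝ))
    (fun t => (M.integrable_runLaw σ signal (fun s => M.purchaseProb σ (signal s)) t).1)
    (integrable_const 1)
    (fun t => .of_forall fun d => by
      simpa [abs_of_nonneg (M.purchaseProb_nonneg σ _)] using M.purchaseProb_le_one σ _) h
  rw [integral_const, probReal_univ, one_smul] at hlim
  exact hlim.congr fun t => (M.purchaseProbAt_eq_integral σ signal t).symm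

theorem w_pos (k : Fin K) : 0 < M.w k :=
  div_pos (M.rate_pos k) (Finset.sum_pos (fun l _ => M.rate_pos l) ⟨k, Finset.mem_univ k⟩)

theorem avgQuality_nonneg (i : Fin N) : 0 ≤ M.avgQuality i :=
  Finset.sum_nonneg fun k _ => mul_nonneg (M.w_nonneg k) (M.q_nonneg i k)

theorem avgQuality_pos {i : Fin N} {k : Fin K} (h : 0 < M.q i k) : 0 < M.avgQuality i :=
  Finset.sum_pos' (fun l _ => mul_nonneg (M.w_nonneg l) (M.q_nonneg i l))
    ⟨k, Finset.mem_univ k, mul_pos (M.w_pos k) h⟩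

/-- The sum of the entries of the displayed popularity vector, weighted by the visibilities: the
part of the denominator of `tryProb` that grows with the sales. -/
def popularity (s : Fin N → ℕ) : ℝ :=
  ∑ j, M.v (σ j) * s j

/-- The part of the denominator of `tryProb` that does not depend on the popularity signal: the
total attraction of the bare items, and of trying nothing, for the consumers of class `k`. -/
def baseAttraction (k : Fin K) : ℝ :=
  ∑ j, M.v (σ j) * M.a j k + M.z

theorem tryProb_eq (s : Fin N → ℕ) (i : Fin N) (k : Fin K) :
    M.tryProb σ s i k =
      M.v (σ i) * (s i + M.a i k) / (M.popularity σ s + M.baseAttraction σ k) := by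
  simp only [tryProb, popularity, baseAttraction, mul_add, Finset.sum_add_distrib]
  ring_nf

theorem baseAttraction_nonneg (k : Fin K) : 0 ≤ M.baseAttraction σ k :=
  add_nonneg (Finset.sum_nonneg fun j _ => mul_nonneg (M.v_nonneg _) (M.a_pos j k).le) M.z_nonneg

theorem popularity_nonneg (s : Fin N → ℕ) : 0 ≤ M.popularity σ s :=
  Finset.sum_nonneg fun _ _ => mul_nonneg (M.v_nonneg _) (Nat.cast_nonneg _)

theorem mul_le_popularity (s : Fin N → ℕ) (i : Fin N) : M.v (σ i) * s i ≤ M.popularity σ s :=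
  Finset.single_le_sum (f := fun j => M.v (σ j) * (s j : ℝ))
    (fun _ _ => mul_nonneg (M.v_nonneg _) (Nat.cast_nonneg _)) (Finset.mem_univ i)

variable {M σ} {m i j : Fin N} {A α η : ℝ}

theorem baseAttraction_pos (hm : 0 < M.v (σ m)) (k : Fin K) : 0 < M.baseAttraction σ k :=
  add_pos_of_pos_of_nonneg (Finset.sum_pos'
    (fun j _ => mul_nonneg (M.v_nonneg _) (M.a_pos j k).le)
    ⟨m, Finset.mem_univ m, mul_pos hm (M.a_pos m k)⟩) M.z_nonneg

theorem popularity_pos (hm : 0 < M.v (σ m)) (hs : 0 < s m) : 0 < M.popularity σ s :=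
  (mul_pos hm (Nat.cast_pos.2 hs)).trans_le (M.mul_le_popularity σ s m)

theorem popularity_le {V : ℝ} (hV : ∀ j, M.v j ≤ V) (s : Fin N → ℕ) :
    M.popularity σ s ≤ V * (∑ i, s i : ℕ) := by
  rw [Nat.cast_sum, Finset.mul_sum]
  exact Finset.sum_le_sum fun j _ => mul_le_mul_of_nonneg_right (hV _) (Nat.cast_nonneg _)

theorem avgQuality_mul_le_buyProb {c : ℝ} (hc : ∀ k, c ≤ M.tryProb σ s i k) :
    M.avgQuality i * c ≤ M.buyProb σ s i := by
  rw [avgQuality, buyProb, Finset.sum_mul]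
  refine Finset.sum_le_sum fun k _ => ?_
  rw [mul_assoc, mul_comm (M.q i k)]
  exact mul_le_mul_of_nonneg_left (mul_le_mul_of_nonneg_right (hc k) (M.q_nonneg i k))
    (M.w_nonneg k)

theorem buyProb_le_avgQuality_mul {c : ℝ} (hc : ∀ k, M.tryProb σ s i k ≤ c) :
    M.buyProb σ s i ≤ M.avgQuality i * c := by
  rw [avgQuality, buyProb, Finset.sum_mul]
  refine Finset.sum_le_sum fun k _ => ?_
  rw [mul_assoc, mul_comm (M.q i k)]
  exact mul_le_mul_of_nonneg_left (mul_le_mul_of_nonneg_right (hc k) (M.q_nonneg i k))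
    (M.w_nonneg k)

theorem div_le_buyProb (hi : 0 < M.v (σ i)) (hα : ∀ k, α ≤ M.a i k)
    (hA : ∀ k, M.baseAttraction σ k ≤ A) (s : Fin N → ℕ) :
    M.avgQuality i * (M.v (σ i) * (s i + α) / (M.popularity σ s + A)) ≤ M.buyProb σ s i := by
  refine avgQuality_mul_le_buyProb fun k => ?_
  rw [tryProb_eq]
  have hnum : 0 ≤ M.v (σ i) * (s i + M.a i k) :=
    mul_nonneg hi.le (add_nonneg (Nat.cast_nonneg _) (M.a_pos i k).le)
  exact div_le_div₀ hnum
    (mul_le_mul_of_nonneg_left (add_le_add_right (hα k) _) hi.le)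
    (add_pos_of_nonneg_of_pos (M.popularity_nonneg σ s) (baseAttraction_pos hi k))
    (add_le_add_right (hA k) _)

theorem buyProb_le_div (hs : 0 < M.popularity σ s) (hα : ∀ k, M.a j k ≤ α) :
    M.buyProb σ s j ≤ M.avgQuality j * (M.v (σ j) * (s j + α) / M.popularity σ s) := by
  refine buyProb_le_avgQuality_mul fun k => ?_
  rw [tryProb_eq]
  have hα0 : 0 ≤ α := (M.a_pos j k).le.trans (hα k)
  exact div_le_div₀ (mul_nonneg (M.v_nonneg _) (by positivity))
    (mul_le_mul_of_nonneg_left (add_le_add_right (hα k) _) (M.v_nonneg _)) hs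
    (le_add_of_nonneg_right (M.baseAttraction_nonneg σ k))

theorem drift_coord (d : Fin N → ℕ) (m : Fin N) :
    M.drift σ signal (fun s => s m) d = M.buyProb σ (signal d) m := by
  rw [drift, Finset.sum_eq_single m (fun i _ hi => by simp [Pi.single_eq_of_ne hi.symm]) (by simp)]
  simp

theorem exists_forall_baseAttraction_le (M : MMNLMarket N K) (σ : Equiv.Perm (Fin N)) :
    ∃ A, ∀ k, M.baseAttraction σ k ≤ A := by
  obtain ⟨A, hA⟩ := (Set.finite_range (M.baseAttraction σ)).bddAbove
  exact ⟨A, Set.forall_mem_range.1 hA⟩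

theorem exists_div_le_buyProb (hm : 0 < M.v (σ m)) (hq : 0 < M.avgQuality m) :
    ∃ c, 0 < c ∧ ∀ (s : Fin N → ℕ) (t : ℕ), ∑ i, s i ≤ t → c / (t + 1) ≤ M.buyProb σ s m := by
  have : Nonempty (Fin K) := ⟨⟨0, M.K_pos⟩⟩
  obtain ⟨A, hA⟩ := M.exists_forall_baseAttraction_le σ
  obtain ⟨V, hV⟩ := (Set.finite_range M.v).bddAbove
  obtain ⟨k₀, hk₀⟩ := Finite.exists_min (M.a m)
  have hA0 : 0 < A := (baseAttraction_pos hm k₀).trans_le (hA k₀)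
  have hV0 : 0 < V := hm.trans_le (hV ⟨_, rfl⟩)
  have ha := M.a_pos m k₀
  refine ⟨M.avgQuality m * (M.v (σ m) * M.a m k₀ / (V + A)), by positivity, fun s t ht => ?_⟩
  have hpop : M.popularity σ s ≤ V * t :=
    (popularity_le (Set.forall_mem_range.1 hV) s).trans (by gcongr)
  have hpop0 := M.popularity_nonneg σ s
  have hden : M.popularity σ s + A ≤ (V + A) * (t + 1) := by
    nlinarith [mul_nonneg hA0.le (Nat.cast_nonneg (α := ℝ) t)]
  calc M.avgQuality m * (M.v (σ m) * M.a m k₀ / (V + A)) / (t + 1)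
      = M.avgQuality m * (M.v (σ m) * M.a m k₀ / ((V + A) * (t + 1))) := by field_simp
    _ ≤ M.avgQuality m * (M.v (σ m) * (s m + M.a m k₀) / (M.popularity σ s + A)) := by
        gcongr
        exact le_add_of_nonneg_left (Nat.cast_nonneg _)
    _ ≤ M.buyProb σ s m := div_le_buyProb hm hk₀ hA s

theorem ae_tendsto_sales (hm : 0 < M.v (σ m)) (hq : 0 < M.avgQuality m) :
    ∀ᵐ d ∂M.runLaw σ globalSignal, Tendsto (fun t => (d t m : ℝ)) atTop atTop := by
  obtain ⟨c, hc, hle⟩ := exists_div_le_buyProb hm hq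
  refine ae_tendsto_atTop_of_div_le_condExp_sub (ℱ := history N) (R := 1)
    (fun t => stronglyMeasurable_history (fun s => s m) t)
    (M.integrable_runLaw σ globalSignal fun s => s m) ?_ ?_ hc fun t => ?_
  · filter_upwards [M.ae_runLaw_monotone σ globalSignal] with d hd t
    exact Nat.cast_le.2 (hd t.le_succ m)
  · filter_upwards [M.ae_runLaw_step σ globalSignal] with d hd t
    rcases hd t with h | ⟨i, h⟩
    · simp [h]
    · rcases eq_or_ne m i with rfl | hi
      · simp [h]
      · simp [h, Pi.single_eq_of_ne hi]
  · filter_upwards [M.condExp_runLaw_sub σ globalSignal (fun s => s m) t,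
      M.ae_runLaw_le σ globalSignal] with d hd hsum
    exact (hle (d t) t (hsum t)).trans (hd.trans (drift_coord globalSignal (d t) m)).ge

/-- A power-law comparison of the sales of item `j` with those of item `m`. The offset `α` dominates
the appeals of `j`, so that the sales of `j` grow at most at a rate proportional to `s j + α`. -/
def salesRatio (α : ℝ) (m j : Fin N) (η : ℝ) (s : Fin N → ℕ) : ℝ :=
  (s j + α) * (s m : ℝ) ^ (-η)

theorem drift_salesRatio (hne : j ≠ m) (α η : ℝ) (d : Fin N → ℕ) :
    M.drift σ signal (salesRatio α m j η) d =
      M.buyProb σ (signal d) j * (d m : ℝ) ^ (-η) + M.buyProb σ (signal d) m *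
        ((d j + α) * (((d m : ℝ) + 1) ^ (-η) - (d m : ℝ) ^ (-η))) := by
  rw [drift, Finset.sum_eq_add j m hne ?_ (by simp) (by simp)]
  · simp only [salesRatio, Pi.add_apply, Pi.single_eq_same, Pi.single_eq_of_ne hne,
      Pi.single_eq_of_ne hne.symm, Nat.cast_add, Nat.cast_one, add_zero]
    ring
  · rintro i - ⟨hij, him⟩
    simp [salesRatio, Pi.single_eq_of_ne hij.symm, Pi.single_eq_of_ne him.symm]

theorem buyProb_mul_add_one_le (hm : 0 < M.v (σ m)) (hA : ∀ k, M.baseAttraction σ k ≤ A)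
    (hα : ∀ k, M.a j k ≤ α) (hη₀ : 0 ≤ η) (hs : 0 < s m)
    (hη : M.v (σ j) * M.avgQuality j * ((1 + 1 / s m) * (1 + A / (M.v (σ m) * s m))) ≤
      η * (M.v (σ m) * M.avgQuality m)) :
    M.buyProb σ s j * (s m + 1) ≤ η * (M.buyProb σ s m * (s j + α)) := by
  let k₀ : Fin K := ⟨0, M.K_pos⟩
  have hA0 : 0 < A := (baseAttraction_pos hm k₀).trans_le (hA k₀)
  have hα0 : 0 ≤ α := (M.a_pos j k₀).le.trans (hα k₀)
  have hS : 0 < M.popularity σ s := popularity_pos hm hs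
  have hSm : M.v (σ m) * s m ≤ M.popularity σ s := M.mul_le_popularity σ s m
  have hvj := M.v_nonneg (σ j)
  have hqj := M.avgQuality_nonneg j
  have hlower := div_le_buyProb hm (fun k => (M.a_pos m k).le) hA s
  rw [add_zero] at hlower
  calc M.buyProb σ s j * (s m + 1)
      ≤ M.avgQuality j * (M.v (σ j) * (s j + α) / M.popularity σ s) * (s m + 1) := by
        gcongr
        exact buyProb_le_div hS hα
    _ = M.v (σ j) * M.avgQuality j * ((1 + 1 / s m) * (1 + A / M.popularity σ s)) *
          (s m * (s j + α) / (M.popularity σ s + A)) := by field_simp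
    _ ≤ M.v (σ j) * M.avgQuality j * ((1 + 1 / s m) * (1 + A / (M.v (σ m) * s m))) *
          (s m * (s j + α) / (M.popularity σ s + A)) := by gcongr
    _ ≤ η * (M.v (σ m) * M.avgQuality m) * (s m * (s j + α) / (M.popularity σ s + A)) := by
        gcongr
    _ = η * (M.avgQuality m * (M.v (σ m) * s m / (M.popularity σ s + A)) * (s j + α)) := by ring
    _ ≤ η * (M.buyProb σ s m * (s j + α)) := by gcongr

theorem drift_salesRatio_nonpos (hne : j ≠ m) (hα : 0 ≤ α) (hη₀ : 0 ≤ η) (hη₁ : η ≤ 1)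
    {d : Fin N → ℕ} (hd : 0 < d m)
    (hbuy : M.buyProb σ (signal d) j * (d m + 1) ≤
      η * (M.buyProb σ (signal d) m * (d j + α))) :
    M.drift σ signal (salesRatio α m j η) d ≤ 0 := by
  have hn : (0 : ℝ) < d m := Nat.cast_pos.2 hd
  have hpow : ((d m : ℝ) + 1) ^ (-η) - (d m : ℝ) ^ (-η) ≤
      (d m : ℝ) ^ (-η) * -(η / (d m + 1)) := by
    linarith [rpow_neg_add_one_le hη₀ hη₁ hn]
  have hbm := M.buyProb_nonneg σ (signal d) m
  rw [drift_salesRatio signal hne]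
  calc _ ≤ M.buyProb σ (signal d) j * (d m : ℝ) ^ (-η) + M.buyProb σ (signal d) m *
        ((d j + α) * ((d m : ℝ) ^ (-η) * -(η / (d m + 1)))) := by gcongr
    _ = (d m : ℝ) ^ (-η) / (d m + 1) * (M.buyProb σ (signal d) j * (d m + 1) -
        η * (M.buyProb σ (signal d) m * (d j + α))) := by field_simp; ring
    _ ≤ 0 := mul_nonpos_of_nonneg_of_nonpos (by positivity) (sub_nonpos.2 hbuy)

theorem eventually_mul_le_of_lt {x y : ℝ} (hxy : x < y) (A V : ℝ) :
    ∀ᶠ n : ℕ in atTop, x * ((1 + 1 / n) * (1 + A / (V * n))) ≤ y := by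
  have hlim : Tendsto (fun n : ℕ => x * ((1 + 1 / (n : ℝ)) * (1 + A / V / n))) atTop
      (𝓝 (x * ((1 + 0) * (1 + 0)))) :=
    (((tendsto_const_div_atTop_nhds_zero_nat 1).const_add 1).mul
      ((tendsto_const_div_atTop_nhds_zero_nat (A / V)).const_add 1)).const_mul x
  simp only [div_div, add_zero, mul_one] at hlim
  exact hlim.eventually_le_const hxy

theorem exists_drift_salesRatio_nonpos (hm : 0 < M.v (σ m)) (hα : ∀ k, M.a j k ≤ α)
    (hη₀ : 0 ≤ η) (hη₁ : η ≤ 1)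
    (hη : M.v (σ j) * M.avgQuality j < η * (M.v (σ m) * M.avgQuality m)) :
    ∃ n₀, ∀ d : Fin N → ℕ, n₀ ≤ d m → M.drift σ globalSignal (salesRatio α m j η) d ≤ 0 := by
  have hne : j ≠ m := by
    rintro rfl
    exact hη.not_ge (mul_le_of_le_one_left (mul_nonneg hm.le (M.avgQuality_nonneg j)) hη₁)
  have hα0 : 0 ≤ α := (M.a_pos j ⟨0, M.K_pos⟩).le.trans (hα _)
  obtain ⟨A, hA⟩ := M.exists_forall_baseAttraction_le σ
  obtain ⟨n₀, hn₀⟩ := eventually_atTop.1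
    ((eventually_gt_atTop 0).and (eventually_mul_le_of_lt hη A (M.v (σ m))))
  refine ⟨n₀, fun d hd => ?_⟩
  obtain ⟨hpos, hbound⟩ := hn₀ (d m) hd
  exact drift_salesRatio_nonpos globalSignal hne hα0 hη₀ hη₁ hpos
    (buyProb_mul_add_one_le hm hA hα hη₀ hpos hbound)

theorem ae_exists_tendsto_salesRatio (hm : 0 < M.v (σ m)) (hq : 0 < M.avgQuality m)
    (hα : ∀ k, M.a j k ≤ α) (hη₀ : 0 ≤ η) (hη₁ : η ≤ 1)
    (hη : M.v (σ j) * M.avgQuality j < η * (M.v (σ m) * M.avgQuality m)) :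
    ∀ᵐ d ∂M.runLaw σ globalSignal, ∃ c,
      Tendsto (fun t => salesRatio α m j η (d t)) atTop (𝓝 c) := by
  obtain ⟨n₀, hn₀⟩ := exists_drift_salesRatio_nonpos hm hα hη₀ hη₁ hη
  have hα0 : 0 ≤ α := (M.a_pos j ⟨0, M.K_pos⟩).le.trans (hα _)
  have hlate (T : ℕ) : ∀ᵐ d ∂M.runLaw σ globalSignal, n₀ ≤ d T m →
      ∃ c, Tendsto (fun t => salesRatio α m j η (d t)) atTop (𝓝 c) := by
    have hs : MeasurableSet[history N T] {d | n₀ ≤ d T m} := by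
      simpa only [Nat.cast_le] using measurableSet_le (measurable_const (a := (n₀ : ℝ)))
        (stronglyMeasurable_history (fun s => s m) T).measurable
    refine (ae_restrict_iff' ((history N).le T _ hs)).1
      (ae_restrict_exists_tendsto_of_condExp_sub_nonpos (ℱ := history N)
        (fun t => stronglyMeasurable_history (salesRatio α m j η) t)
        (M.integrable_runLaw σ globalSignal _) (fun t d => ?_) hs fun t ht => ?_)
    · exact mul_nonneg (by positivity) (Real.rpow_nonneg (Nat.cast_nonneg _) _)
    · filter_upwards [ae_restrict_of_ae (M.condExp_runLaw_sub σ globalSignal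
        (salesRatio α m j η) t), ae_restrict_of_ae (M.ae_runLaw_monotone σ globalSignal),
        ae_restrict_mem ((history N).le T _ hs)] with d hd hmono hdT
      exact hd.trans_le (hn₀ (d t) (le_trans hdT (hmono ht m)))
  filter_upwards [ae_all_iff.2 hlate, ae_tendsto_sales hm hq] with d hd hsales
  obtain ⟨T, hT⟩ := (hsales.eventually_ge_atTop (n₀ : ℝ)).exists
  exact hd T (Nat.cast_le.1 hT)

theorem ae_tendsto_sales_div_sales (hm : 0 < M.v (σ m)) (hq : 0 < M.avgQuality m)
    (hjm : M.v (σ j) * M.avgQuality j < M.v (σ m) * M.avgQuality m) :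
    ∀ᵐ d ∂M.runLaw σ globalSignal,
      Tendsto (fun t => (d t j : ℝ) / d t m) atTop (𝓝 0) := by
  have hvq : 0 < M.v (σ m) * M.avgQuality m := mul_pos hm hq
  obtain ⟨η, hη, hη₁⟩ := exists_between ((div_lt_one hvq).2 hjm)
  have hη₀ : 0 ≤ η :=
    (div_nonneg (mul_nonneg (M.v_nonneg _) (M.avgQuality_nonneg j)) hvq.le).trans hη.le
  obtain ⟨α, hα⟩ := (Set.finite_range (M.a j)).bddAbove
  have hα0 : 0 ≤ α := (M.a_pos j ⟨0, M.K_pos⟩).le.trans (hα ⟨_, rfl⟩)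
  filter_upwards [ae_exists_tendsto_salesRatio hm hq (Set.forall_mem_range.1 hα) hη₀ hη₁.le
    ((div_lt_iff₀ hvq).1 hη), ae_tendsto_sales hm hq] with d ⟨c, hc⟩ hsales
  have hlim := hc.mul ((tendsto_rpow_neg_atTop (sub_pos.2 hη₁)).comp hsales)
  rw [mul_zero] at hlim
  refine squeeze_zero' (.of_forall fun t => by positivity) ?_ hlim
  filter_upwards [hsales.eventually_gt_atTop 0] with t ht
  calc (d t j : ℝ) / d t m ≤ (d t j + α) / d t m := by gcongr; linarith
    _ = salesRatio α m j η (d t) * (d t m : ℝ) ^ (-(1 - η)) := by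
        rw [salesRatio, mul_assoc, ← Real.rpow_add ht, div_eq_mul_inv, ← Real.rpow_neg_one]
        ring_nf

/-- The share of item `i` in the popularity: what the probability that a consumer tries item `i`
becomes, for all classes alike, when the sales are large. -/
def popularityShare (M : MMNLMarket N K) (σ : Equiv.Perm (Fin N)) (s : Fin N → ℕ)
    (i : Fin N) : ℝ :=
  M.v (σ i) * s i / M.popularity σ s

theorem popularityShare_nonneg (M : MMNLMarket N K) (σ : Equiv.Perm (Fin N)) (s : Fin N → ℕ)
    (i : Fin N) : 0 ≤ M.popularityShare σ s i :=
  div_nonneg (mul_nonneg (M.v_nonneg _) (Nat.cast_nonneg _)) (M.popularity_nonneg σ s)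

theorem popularityShare_le_one (M : MMNLMarket N K) (σ : Equiv.Perm (Fin N)) (s : Fin N → ℕ)
    (i : Fin N) : M.popularityShare σ s i ≤ 1 :=
  div_le_one_of_le₀ (M.mul_le_popularity σ s i) (M.popularity_nonneg σ s)

theorem sum_popularityShare (hs : 0 < M.popularity σ s) : ∑ i, M.popularityShare σ s i = 1 := by
  simp only [popularityShare, ← Finset.sum_div]
  exact div_self hs.ne'

theorem popularityShare_le (hm : 0 < M.v (σ m)) (hs : 0 < s m) (j : Fin N) :
    M.popularityShare σ s j ≤ M.v (σ j) / M.v (σ m) * (s j / s m) := by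
  have hsm : (0 : ℝ) < s m := Nat.cast_pos.2 hs
  rw [div_mul_div_comm]
  exact div_le_div_of_nonneg_left (mul_nonneg (M.v_nonneg _) (Nat.cast_nonneg _))
    (mul_pos hm hsm) (M.mul_le_popularity σ s m)

theorem abs_tryProb_sub_popularityShare_le (hs : 0 < M.popularity σ s) (i : Fin N) (k : Fin K) :
    |M.tryProb σ s i k - M.popularityShare σ s i| ≤
      (M.v (σ i) * M.a i k + M.baseAttraction σ k) / M.popularity σ s := by
  have hbase := M.baseAttraction_nonneg σ k
  have hva : 0 ≤ M.v (σ i) * M.a i k := mul_nonneg (M.v_nonneg _) (M.a_pos i k).le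
  have hshare := mul_le_of_le_one_left hbase (M.popularityShare_le_one σ s i)
  have hshare0 := mul_nonneg (M.popularityShare_nonneg σ s i) hbase
  have hdiff : M.tryProb σ s i k - M.popularityShare σ s i =
      (M.v (σ i) * M.a i k - M.popularityShare σ s i * M.baseAttraction σ k) /
        (M.popularity σ s + M.baseAttraction σ k) := by
    have hden : M.popularity σ s + M.baseAttraction σ k ≠ 0 := by positivity
    rw [tryProb_eq, popularityShare]
    field_simp
    ring
  rw [hdiff, abs_div, abs_of_pos (add_pos_of_pos_of_nonneg hs hbase)]
  refine div_le_div₀ (add_nonneg hva hbase) ?_ hs (le_add_of_nonneg_right hbase)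
  exact abs_le.2 ⟨by linarith, by linarith⟩

theorem purchaseProb_sub_eq (hs : 0 < M.popularity σ s) (C : ℝ) :
    M.purchaseProb σ s - C =
      ∑ k, M.w k * ∑ i, (M.tryProb σ s i k - M.popularityShare σ s i) * M.q i k +
        ∑ i, (M.avgQuality i - C) * M.popularityShare σ s i := by
  have hquality : ∑ k, M.w k * ∑ i, M.popularityShare σ s i * M.q i k =
      ∑ i, M.avgQuality i * M.popularityShare σ s i := by
    simp only [avgQuality, Finset.mul_sum, Finset.sum_mul]
    rw [Finset.sum_comm]
    exact Finset.sum_congr rfl fun i _ => Finset.sum_congr rfl fun k _ => by ring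
  simp only [purchaseProb, sub_mul, Finset.sum_sub_distrib, mul_sub, ← Finset.mul_sum,
    sum_popularityShare hs, hquality]
  ring

theorem tendsto_tryProb_sub_popularityShare {s : ℕ → Fin N → ℕ}
    (hs : Tendsto (fun t => M.popularity σ (s t)) atTop atTop) (i : Fin N) (k : Fin K) :
    Tendsto (fun t => M.tryProb σ (s t) i k - M.popularityShare σ (s t) i) atTop (𝓝 0) := by
  refine squeeze_zero_norm' ?_
    (hs.const_div_atTop (M.v (σ i) * M.a i k + M.baseAttraction σ k))
  filter_upwards [hs.eventually_gt_atTop 0] with t ht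
  exact abs_tryProb_sub_popularityShare_le ht i k

theorem tendsto_popularityShare (hm : 0 < M.v (σ m)) {s : ℕ → Fin N → ℕ}
    (hs : Tendsto (fun t => (s t m : ℝ)) atTop atTop)
    (hj : Tendsto (fun t => (s t j : ℝ) / s t m) atTop (𝓝 0)) :
    Tendsto (fun t => M.popularityShare σ (s t) j) atTop (𝓝 0) := by
  have hlim := hj.const_mul (M.v (σ j) / M.v (σ m))
  rw [mul_zero] at hlim
  refine squeeze_zero' (.of_forall fun t => M.popularityShare_nonneg σ (s t) j) ?_ hlim
  filter_upwards [hs.eventually_gt_atTop 0] with t ht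
  exact popularityShare_le hm (Nat.cast_pos.1 ht) j

theorem tendsto_purchaseProb (hm : 0 < M.v (σ m)) {s : ℕ → Fin N → ℕ}
    (hs : Tendsto (fun t => (s t m : ℝ)) atTop atTop)
    (hneg : ∀ j, M.avgQuality j ≠ M.avgQuality m →
      Tendsto (fun t => (s t j : ℝ) / s t m) atTop (𝓝 0)) :
    Tendsto (fun t => M.purchaseProb σ (s t)) atTop (𝓝 (M.avgQuality m)) := by
  have hpop : Tendsto (fun t => M.popularity σ (s t)) atTop atTop :=
    tendsto_atTop_mono (fun t => M.mul_le_popularity σ (s t) m) (hs.const_mul_atTop hm)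
  have htry : Tendsto (fun t => ∑ k, M.w k * ∑ i,
      (M.tryProb σ (s t) i k - M.popularityShare σ (s t) i) * M.q i k)
      atTop (𝓝 (∑ k, M.w k * ∑ i, 0 * M.q i k)) :=
    tendsto_finsetSum _ fun k _ => Tendsto.const_mul _ <| tendsto_finsetSum _ fun i _ =>
      (tendsto_tryProb_sub_popularityShare hpop i k).mul_const _
  have hshare : Tendsto (fun t => ∑ i, (M.avgQuality i - M.avgQuality m) *
      M.popularityShare σ (s t) i) atTop (𝓝 (∑ _i : Fin N, 0)) := by
    refine tendsto_finsetSum _ fun i _ => ?_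
    rcases eq_or_ne (M.avgQuality i) (M.avgQuality m) with h | h
    · simp [h]
    · simpa using (tendsto_popularityShare hm hs (hneg i h)).const_mul
        (M.avgQuality i - M.avgQuality m)
  have hlim := htry.add hshare
  simp only [zero_mul, Finset.sum_const_zero, mul_zero, add_zero] at hlim
  refine tendsto_sub_nhds_zero_iff.1 (hlim.congr' ?_)
  filter_upwards [hpop.eventually_gt_atTop 0] with t ht
  exact (purchaseProb_sub_eq ht (M.avgQuality m)).symm

theorem purchaseProb_le_mul_of_avgQuality_le {C : ℝ} (hC : ∀ i, M.avgQuality i ≤ C)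
    (h0 : 0 ≤ C) (σ : Equiv.Perm (Fin N)) (s : Fin N → ℕ) : M.purchaseProb σ s ≤ K * C := by
  have hwq (i : Fin N) (k : Fin K) : M.w k * M.q i k ≤ C :=
    (Finset.single_le_sum (f := fun k => M.w k * M.q i k)
      (fun l _ => mul_nonneg (M.w_nonneg l) (M.q_nonneg i l)) (Finset.mem_univ k)).trans (hC i)
  have hclass (k : Fin K) : M.w k * ∑ i, M.tryProb σ s i k * M.q i k ≤ C :=
    calc M.w k * ∑ i, M.tryProb σ s i k * M.q i k
        = ∑ i, M.tryProb σ s i k * (M.w k * M.q i k) := by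
          simp only [Finset.mul_sum, mul_left_comm]
      _ ≤ ∑ i, M.tryProb σ s i k * C := Finset.sum_le_sum fun i _ =>
          mul_le_mul_of_nonneg_left (hwq i k) (M.tryProb_nonneg σ s i k)
      _ = (∑ i, M.tryProb σ s i k) * C := by rw [Finset.sum_mul]
      _ ≤ C := mul_le_of_le_one_left h0 (M.sum_tryProb_le_one σ s k)
  calc M.purchaseProb σ s ≤ ∑ _k : Fin K, C := Finset.sum_le_sum fun k _ => hclass k
    _ = K * C := by simp

/-- With the popularity signal, the relative growth rate of the sales of item `i` is proportional to
`v (σ i) * avgQuality i`. The item `m` leads the market under the ranking `σ` if it can be sold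
and if this rate is strictly larger for `m` than for every item of a different average quality. -/
structure IsMarketLeader (M : MMNLMarket N K) (σ : Equiv.Perm (Fin N)) (m : Fin N) : Prop where
  visibility_pos : 0 < M.v (σ m)
  avgQuality_pos : 0 < M.avgQuality m
  mul_lt_mul : ∀ j, M.avgQuality j ≠ M.avgQuality m →
    M.v (σ j) * M.avgQuality j < M.v (σ m) * M.avgQuality m

theorem IsMarketLeader.ae_tendsto_purchaseProb (hm : M.IsMarketLeader σ m) :
    ∀ᵐ d ∂M.runLaw σ globalSignal,
      Tendsto (fun t => M.purchaseProb σ (globalSignal (d t))) atTop (𝓝 (M.avgQuality m)) := by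
  have hratio : ∀ᵐ d ∂M.runLaw σ globalSignal, ∀ j, M.avgQuality j ≠ M.avgQuality m →
      Tendsto (fun t => (d t j : ℝ) / d t m) atTop (𝓝 0) := by
    refine ae_all_iff.2 fun j => ?_
    by_cases hj : M.avgQuality j = M.avgQuality m
    · exact .of_forall fun d h => absurd hj h
    · filter_upwards [ae_tendsto_sales_div_sales hm.visibility_pos hm.avgQuality_pos
        (hm.mul_lt_mul j hj)] with d hd _ using hd
  filter_upwards [ae_tendsto_sales hm.visibility_pos hm.avgQuality_pos, hratio] with d hd hneg
  exact tendsto_purchaseProb hm.visibility_pos hd hneg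

theorem IsAverageQualityRanking.exists_isMarketLeader (hσ : M.IsAverageQualityRanking σ)
    (hv : ∃ j, 0 < M.v j) (hq : ∃ i k, 0 < M.q i k) :
    ∃ m, M.IsMarketLeader σ m ∧ ∀ j, M.avgQuality j ≤ M.avgQuality m := by
  obtain ⟨j₀, hj₀⟩ := hv
  obtain ⟨i₀, k₀, hik⟩ := hq
  have : NeZero N := ⟨j₀.pos.ne'⟩
  have hmax (j : Fin N) : M.avgQuality j ≤ M.avgQuality (σ.symm 0) := by
    by_contra! h
    simpa using hσ _ _ h
  have hvis (j : Fin N) : M.v (σ j) ≤ M.v (σ (σ.symm 0)) := by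
    rw [Equiv.apply_symm_apply]
    exact M.v_antitone (Fin.zero_le _)
  have hvpos : 0 < M.v (σ (σ.symm 0)) := by
    rw [Equiv.apply_symm_apply]
    exact hj₀.trans_le (M.v_antitone (Fin.zero_le _))
  refine ⟨σ.symm 0, ⟨hvpos, (M.avgQuality_pos hik).trans_le (hmax i₀), fun j hj => ?_⟩, hmax⟩
  exact mul_lt_mul' (hvis j) (lt_of_le_of_ne (hmax j) hj) (M.avgQuality_nonneg j) hvpos

end

end MMNLMarket

theorem mainTheorem4_general {N K : ℕ} (M : MMNLMarket N K) (σ : Equiv.Perm (Fin N)) (m : Fin N)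
    (hm : M.IsMarketLeader σ m) (hmax : ∀ j, M.avgQuality j ≤ M.avgQuality m) :
    ∃ PAQGSI PAQNSI : ℝ,
      Tendsto (M.purchaseProbAt σ MMNLMarket.globalSignal) atTop (𝓝 PAQGSI) ∧
      (∀ᵐ d ∂(M.runLaw σ MMNLMarket.globalSignal),
        Tendsto (fun t => M.purchaseProb σ (MMNLMarket.globalSignal (d t))) atTop
          (𝓝 PAQGSI)) ∧
      IsGreatest (Set.range M.avgQuality) PAQGSI ∧
      Tendsto (M.purchaseProbAt σ MMNLMarket.noSignal) atTop (𝓝 PAQNSI) ∧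
      PAQNSI = ∑ k, M.w k * ∑ i, M.q i k *
        (M.v (σ i) * M.a i k / (∑ j, M.v (σ j) * M.a j k + M.z)) ∧
      0 < PAQGSI ∧ 0 ≤ PAQNSI / PAQGSI ∧ PAQNSI / PAQGSI ≤ K := by
  have hpos := hm.avgQuality_pos
  have hae := hm.ae_tendsto_purchaseProb
  refine ⟨M.avgQuality m, M.purchaseProb σ 0, M.tendsto_purchaseProbAt σ _ hae, hae,
    ⟨⟨m, rfl⟩, Set.forall_mem_range.2 hmax⟩, ?_, ?_, hpos,
    div_nonneg (M.purchaseProb_nonneg σ 0) hpos.le, ?_⟩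
  · simp only [funext (M.purchaseProbAt_noSignal σ), tendsto_const_nhds]
  · simp [MMNLMarket.purchaseProb, MMNLMarket.tryProb, mul_comm (M.q _ _)]
  · rw [div_le_iff₀ hpos]
    exact MMNLMarket.purchaseProb_le_mul_of_avgQuality_le hmax hpos.le σ 0

theorem mainTheorem4 {N K : ℕ} (M : MMNLMarket N K)
    (hv : ∃ j, 0 < M.v j) (hq : ∃ i k, 0 < M.q i k)
    (σ : Equiv.Perm (Fin N)) (hσ : M.IsAverageQualityRanking σ) :
    ∃ PAQGSI PAQNSI : ℝ,
      Tendsto (M.purchaseProbAt σ MMNLMarket.globalSignal) atTop (𝓝 PAQGSI) ∧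
      (∀ᵐ d ∂(M.runLaw σ MMNLMarket.globalSignal),
        Tendsto (fun t => M.purchaseProb σ (MMNLMarket.globalSignal (d t))) atTop
          (𝓝 PAQGSI)) ∧
      IsGreatest (Set.range M.avgQuality) PAQGSI ∧
      Tendsto (M.purchaseProbAt σ MMNLMarket.noSignal) atTop (𝓝 PAQNSI) ∧
      PAQNSI = ∑ k, M.w k * ∑ i, M.q i k *
        (M.v (σ i) * M.a i k / (∑ j, M.v (σ j) * M.a j k + M.z)) ∧
      0 < PAQGSI ∧ 0 ≤ PAQNSI / PAQGSI ∧ PAQNSI / PAQGSI ≤ K := by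
  obtain ⟨m, hm, hmax⟩ := hσ.exists_isMarketLeader hv hq
  exact mainTheorem4_general M σ m hm hmax
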